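/- Consider a stationary two-armed bandit. Arm $i\in\{1,2\}$ has reward law $\nu_i$ with mean $\mu_i$, where $|\mu_1-\mu_2|\ge\Delta_\mu>0$, and the optimal arm is the one with the larger mean. Either (a) $\nu_i=\mathcal N(\mu_i,\sigma^2)$ with a common $\sigma>0$ and $\mu_{\min}\le\mu_i\le\mu_{\max}$, and one puts $L=\mu_{\min}-\sigma Q^{-1}(\epsilon_b)$, $U=\mu_{\max}+\sigma Q^{-1}(\epsilon_b)$ with $0<\epsilon_b<\tfrac12$, where $Q$ is the upper tail function of the standard normal law; or (b) the rewards lie in $[0,1]$ almost surely, and $L=0$, $U=1$. Thompson sampling starts with $\alpha_j=\beta_j=1$ for both arms. In each round it draws independent samples $\theta_j\sim\mathrm{Beta}(\alpha_j,\beta_j)$, plays the arm $k$ with the largest $\theta_k$, observes a reward $r\sim\nu_k$, draws $x\in\{0,1\}$ from a Bernoulli trial whose success probability is $(r-L)/(U-L)$ clipped to $[0,1]$, and replaces $\alpha_k$ by $\alpha_k+x$ and $\beta_k$ by $\beta_k+1-x$. Let $N^*(T)$ be the number of plays of the optimal arm in the first $T$ rounds. Let $N\ge 0$ be an integer. Then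 for every integer $$T\;\ge\;T_N=\frac{160}{\Delta_\mu^2}\log\!\left(\frac{80}{\Delta_\mu^2}\right)+2\left[\frac{48}{\Delta_\mu^4}+18+N\right]$$ ($\log$ the natural logarithm) the optimal arm is played at least $N$ times in the mean, $\mathbb E[N^*(T)]\ge N$. Consequently it is played at least about $N$ times when the variance of $N^*(T)$ is low: for every $s>0$, $$\mathbb P\bigl(N^*(T)>N-s\bigr)\;\ge\;1-\frac{\operatorname{Var}(N^*(T))}{s^2}.$$ -/

import Mathlib

open MeasureTheory ProbabilityTheory
open scoped NNReal

noncomputable section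

namespace TwoArmedTS

/-- What happens in one round: the two posterior samples `θ`, the reward that is observed for the
arm that is played, and the outcome of the Bernoulli trial (`true` is a success). -/
abbrev Round := (Fin 2 → ℝ) × ℝ × Bool

/-- For each arm, the numbers of successes and of failures of its Bernoulli trials so far. -/
abbrev Counts := Fin 2 → ℕ × ℕ

/-- The arm whose posterior sample is largest (a tie, which has probability zero, goes to
arm `0`). -/
def argmaxArm (θ : Fin 2 → ℝ) : Fin 2 := if θ 0 < θ 1 then 1 else 0

/-- The reward `r` mapped to `(r - L) / (U - L)`, clipped to `[0, 1]`. -/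
def rescale (L U r : ℝ) : unitInterval := Set.projIcc 0 1 zero_le_one ((r - L) / (U - L))

/-- The number of the rounds recorded in `h` in which arm `j` is played with trial outcome `x`. -/
def countOutcome {ι : Type*} [Fintype ι] (h : ι → Round) (j : Fin 2) (x : Bool) : ℕ :=
  ∑ i, if argmaxArm (h i).1 = j ∧ (h i).2.2 = x then 1 else 0

/-- The counts that determine the posterior after the rounds recorded in `h`. -/
def counts {ι : Type*} [Fintype ι] (h : ι → Round) : Counts :=
  fun j => (countOutcome h j true, countOutcome h j false)

lemma measurable_argmaxArm : Measurable argmaxArm :=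
  Measurable.ite (measurableSet_lt (measurable_pi_apply 0) (measurable_pi_apply 1))
    measurable_const measurable_const

lemma measurable_rescale (L U : ℝ) : Measurable (rescale L U) :=
  continuous_projIcc.measurable.comp (by fun_prop)

lemma measurable_counts {ι : Type*} [Fintype ι] :
    Measurable (counts : (ι → Round) → Counts) := by
  have key : ∀ (j : Fin 2) (x : Bool),
      Measurable (fun h : ι → Round => countOutcome h j x) := by
    intro j x
    refine Finset.measurable_sum _ fun i _ => ?_
    refine Measurable.ite (MeasurableSet.inter ?_ ?_) measurable_const measurable_const
    · exact (measurable_argmaxArm.comp (measurable_fst.comp (measurable_pi_apply i)))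
        (measurableSet_singleton j)
    · exact (measurable_snd.comp (measurable_snd.comp (measurable_pi_apply i)))
        (measurableSet_singleton x)
  exact measurable_pi_lambda _ fun j => (key j true).prodMk (key j false)

/-- Given the reward `r`, a Bernoulli trial with success probability `rescale L U r`. -/
def trialKernel (L U : ℝ) : Kernel ℝ Bool where
  toFun r := bernoulliMeasure true false (rescale L U r)
  measurable' := by
    refine Measure.measurable_of_measurable_coe _ fun s hs => ?_
    have hm := measurable_rescale L U
    classical
    simp_rw [bernoulliMeasure_apply _ hs]
    have h1 : Measurable fun r => (unitInterval.toNNReal (rescale L U r) : ENNReal) :=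
      (unitInterval.toNNReal_continuous.measurable.comp hm).coe_nnreal_ennreal
    have h2 : Measurable fun r =>
        (unitInterval.toNNReal (unitInterval.symm (rescale L U r)) : ENNReal) :=
      ((unitInterval.toNNReal_continuous.comp
        unitInterval.continuous_symm).measurable.comp hm).coe_nnreal_ennreal
    split_ifs <;> first | exact measurable_const | exact h1 | exact h2

instance (L U : ℝ) : IsMarkovKernel (trialKernel L U) :=
  ⟨fun r => inferInstanceAs (IsProbabilityMeasure (bernoulliMeasure true false (rescale L U r)))⟩

/-- Given the arm `j` that is played: a reward with law `ν j`, then a Bernoulli trial. -/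
def playKernel (ν : Fin 2 → Measure ℝ) (L U : ℝ) : Kernel (Fin 2) (ℝ × Bool) :=
  Kernel.ofFunOfCountable fun j => ν j ⊗ₘ trialKernel L U

instance (ν : Fin 2 → Measure ℝ) [∀ i, IsProbabilityMeasure (ν i)] (L U : ℝ) :
    IsMarkovKernel (playKernel ν L U) :=
  ⟨fun j => inferInstanceAs (IsProbabilityMeasure (ν j ⊗ₘ trialKernel L U))⟩

/-- The joint law of the two independent posterior samples `θ j ∼ Beta(α j, β j)`, where
`α j` is `1` plus the number of successes of arm `j` and `β j` is `1` plus the number of its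
failures. -/
def posterior (c : Counts) : Measure (Fin 2 → ℝ) :=
  Measure.pi fun j => betaMeasure ((c j).1 + 1) ((c j).2 + 1)

instance (c : Counts) : IsProbabilityMeasure (posterior c) := by
  have (j : Fin 2) : IsProbabilityMeasure (betaMeasure ((c j).1 + 1) ((c j).2 + 1)) :=
    isProbabilityMeasureBeta (by positivity) (by positivity)
  unfold posterior
  infer_instance

/-- The law of one round of Thompson sampling given the counts: sample `θ` from the posterior,
play the arm with the largest sample, observe its reward, perform the Bernoulli trial. -/
def roundKernel (ν : Fin 2 → Measure ℝ) (L U : ℝ) : Kernel Counts Round :=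
  Kernel.ofFunOfCountable fun c =>
    posterior c ⊗ₘ (playKernel ν L U).comap argmaxArm measurable_argmaxArm

instance (ν : Fin 2 → Measure ℝ) [∀ i, IsProbabilityMeasure (ν i)] (L U : ℝ) :
    IsMarkovKernel (roundKernel ν L U) :=
  ⟨fun c => inferInstanceAs (IsProbabilityMeasure
    (posterior c ⊗ₘ (playKernel ν L U).comap argmaxArm measurable_argmaxArm))⟩

/-- The law of the infinite sequence of rounds of Thompson sampling with `Beta(1, 1)` priors in
the stationary two-armed bandit with reward laws `ν 0`, `ν 1`. -/
def law (ν : Fin 2 → Measure ℝ) [∀ i, IsProbabilityMeasure (ν i)] (L U : ℝ) :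
    Measure (ℕ → Round) :=
  Kernel.trajMeasure (X := fun _ => Round) (roundKernel ν L U 0)
    fun _ => (roundKernel ν L U).comap counts measurable_counts

/-- The number of plays of arm `k` in the first `T` rounds. -/
def plays (k : Fin 2) (T : ℕ) (ω : ℕ → Round) : ℕ :=
  ((Finset.range T).filter fun t => argmaxArm (ω t).1 = k).card

/-- The Gaussian `Q`-function, the upper tail of the standard normal distribution. -/
def gaussianQ (x : ℝ) : ℝ := (gaussianReal 0 1).real (Set.Ioi x)

/-- The reward laws of the two arms, with the range `[L, U]` that is mapped to `[0, 1]` before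
the Bernoulli trial: either Gaussian arms of common variance `σ²`, whose means lie between
`μmin` and `μmax`, with `L = μmin - σ Q⁻¹(ε)` and `U = μmax + σ Q⁻¹(ε)` (here `q = Q⁻¹(ε)`);
or rewards that lie in `[0, 1]` already, which are not rescaled. -/
inductive Rewards : (Fin 2 → Measure ℝ) → ℝ → ℝ → Prop
  | gaussian (μ : Fin 2 → ℝ) (σ : ℝ≥0) (hσ : 0 < σ) (μmin μmax : ℝ)
      (hμ : ∀ i, μmin ≤ μ i ∧ μ i ≤ μmax) (ε q : ℝ) (hε : 0 < ε) (hε' : ε < 1 / 2)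
      (hq : gaussianQ q = ε) :
      Rewards (fun i => gaussianReal (μ i) (σ ^ 2)) (μmin - σ * q) (σ * q + μmax)
  | bounded (ν : Fin 2 → Measure ℝ) (hν : ∀ i, ∀ᵐ r ∂ν i, r ∈ Set.Icc (0 : ℝ) 1) :
      Rewards ν 0 1

/-- The mean reward of arm `i`. -/
def mean (ν : Fin 2 → Measure ℝ) (i : Fin 2) : ℝ := ∫ r, r ∂ν i

/-- The number `T_N` of plays for the minimum gap `Δ`. -/
def playBound (Δ : ℝ) (N : ℕ) : ℝ :=
  160 / Δ ^ 2 * Real.log (80 / Δ ^ 2) + 2 * (48 / Δ ^ 4 + 18 + N)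

end TwoArmedTS

end

noncomputable section

namespace TwoArmedTS

/-! The optimal arm gets at least half of the plays in the mean, and `playBound Δ N` is at least `2
* N`; Chebyshev's inequality then gives the tail bound.

The half comes from monotonicity and symmetry. A reward law enters only through the success
probability of its trial, which is at least as large for the optimal arm
(`successProb_le_of_mean_le`). The mean number of plays of arm `1` is therefore a finite recursion
over the counts, `expectedPlays` (`integral_plays_one`). It increases with the success probability
of arm `1` and decreases with that of arm `0` (`expectedPlays_mono_param`). Exchanging the two
probabilities exchanges the roles of the arms, and the two counts add up to the number of rounds
(`expectedPlays_add_swap`), so the better arm has at least half.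

For the monotonicity, all outcomes of each arm are drawn in advance as a stack. With fixed stacks,
the probability of playing arm `1` depends only on how often each arm has been played. Improving the
stack of arm `1` or worsening that of arm `0` raises these probabilities, by the stochastic order of
Beta laws (`monotonePolicy_playProb`), and this raises the mean number of plays (`stackPlays_mono`).
-/

/-! ### Averages over stacks of Bernoulli trials -/

/-- The mean of `f` under a Bernoulli trial with success probability `p`. -/
def bernoulliMean (p : ℝ) (f : Bool → ℝ) : ℝ := p * f true + (1 - p) * f false

/-- The mean of `f` over the outcomes of `n` independent Bernoulli trials. -/
def stackMean (p : ℝ) : ℕ → (List Bool → ℝ) → ℝ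
  | 0, f => f []
  | n + 1, f => bernoulliMean p fun x => stackMean p n fun l => f (x :: l)

lemma bernoulliMean_mono {p : ℝ} (h0 : 0 ≤ p) (h1 : p ≤ 1) {f f' : Bool → ℝ}
    (h : ∀ x, f x ≤ f' x) : bernoulliMean p f ≤ bernoulliMean p f' :=
  add_le_add (mul_le_mul_of_nonneg_left (h _) h0)
    (mul_le_mul_of_nonneg_left (h _) (sub_nonneg.2 h1))

lemma stackMean_mono {p : ℝ} (h0 : 0 ≤ p) (h1 : p ≤ 1) (n : ℕ) {f f' : List Bool → ℝ}
    (h : ∀ l, f l ≤ f' l) : stackMean p n f ≤ stackMean p n f' := by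
  induction n generalizing f f' with
  | zero => exact h _
  | succ n ih => exact bernoulliMean_mono h0 h1 fun x => ih fun l => h _

lemma stackMean_neg (p : ℝ) (n : ℕ) (f : List Bool → ℝ) :
    stackMean p n (fun l => -f l) = -stackMean p n f := by
  induction n generalizing f with
  | zero => rfl
  | succ n ih => simp only [stackMean, bernoulliMean, ih]; ring

lemma stackMean_affine (p : ℝ) (n : ℕ) (a b d : ℝ) (f f' : List Bool → ℝ) :
    stackMean p n (fun l => a * (d + f l) + b * f' l) =
      a * (d + stackMean p n f) + b * stackMean p n f' := by
  induction n generalizing f f' with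
  | zero => rfl
  | succ n ih => simp only [stackMean, bernoulliMean, ih]; ring

lemma stackMean_bernoulliMean (p q : ℝ) (n : ℕ) (f : Bool → List Bool → ℝ) :
    stackMean p n (fun l => bernoulliMean q fun x => f x l) =
      bernoulliMean q fun x => stackMean p n (f x) := by
  have h := stackMean_affine p n q (1 - q) 0 (f true) (f false)
  simpa [bernoulliMean] using h

/-- A function of the outcomes that is increasing in each of them has a mean that is increasing
in the success probability. -/
lemma stackMean_mono_param {p p' : ℝ} (h0 : 0 ≤ p) (h : p ≤ p') (h1 : p' ≤ 1) (n : ℕ)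
    {f : List Bool → ℝ} (hf : ∀ l l', List.Forall₂ (· ≤ ·) l l' → f l ≤ f l') :
    stackMean p n f ≤ stackMean p' n f := by
  induction n generalizing f with
  | zero => exact le_rfl
  | succ n ih =>
    have step : stackMean p' n (fun l => f (false :: l)) ≤ stackMean p' n fun l => f (true :: l) :=
      stackMean_mono (h0.trans h) h1 n fun l =>
        hf _ _ (.cons (Bool.false_le _) (List.forall₂_refl l))
    have hi (x : Bool) : stackMean p n (fun l => f (x :: l)) ≤ stackMean p' n fun l => f (x :: l) :=
      ih fun l l' hl => hf _ _ (.cons le_rfl hl)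
    -- The parameter of the tail is changed before that of the head; the latter change gains `p' -
    -- p` times the gap in `step`.
    refine (bernoulliMean_mono h0 (h.trans h1) hi).trans ?_
    simp only [stackMean, bernoulliMean]
    nlinarith

/-! ### Plays against fixed stacks -/

/-- The expected number of plays of arm `1` in the next `R` rounds if arm `1` is played with
probability `G n m` whenever arms `1` and `0` have been played `n` and `m` more times. -/
def stackPlays : ℕ → (ℕ → ℕ → ℝ) → ℝ
  | 0, _ => 0
  | R + 1, G => G 0 0 * (1 + stackPlays R fun n m => G (n + 1) m) +
      (1 - G 0 0) * stackPlays R fun n m => G n (m + 1)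

/-- Playing arm `1` rather than arm `0` now does not decrease its total number of plays. -/
lemma stackPlays_le_one_add (R : ℕ) (G : ℕ → ℕ → ℝ) (hG : ∀ n m, 0 ≤ G n m ∧ G n m ≤ 1) :
    (stackPlays R fun n m => G n (m + 1)) ≤ 1 + stackPlays R fun n m => G (n + 1) m := by
  induction R generalizing G with
  | zero => simp [stackPlays]
  | succ R ih =>
    -- Let `X` be the value after one play of each arm. By `h0` the left side is at most `1 + X`,
    -- and by `h1` the right side is at least `1 + X`.
    have h1 := ih (fun n m => G (n + 1) m) fun n m => hG _ _
    have h0 := ih (fun n m => G n (m + 1)) fun n m => hG _ _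
    have b1 := hG 1 0
    have b0 := hG 0 1
    simp only [stackPlays, zero_add] at *
    nlinarith

/-- Later probabilities are compared by induction. Raising the current one moves weight to the
branch that plays arm `1`, which is no worse by `stackPlays_le_one_add`. -/
lemma stackPlays_mono (R : ℕ) (G G' : ℕ → ℕ → ℝ) (hG : ∀ n m, 0 ≤ G n m ∧ G n m ≤ 1)
    (hG' : ∀ n m, 0 ≤ G' n m ∧ G' n m ≤ 1) (h : ∀ n m, G n m ≤ G' n m) :
    stackPlays R G ≤ stackPlays R G' := by
  induction R generalizing G G' with
  | zero => exact le_rfl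
  | succ R ih =>
    have h1 := ih (fun n m => G (n + 1) m) (fun n m => G' (n + 1) m) (fun _ _ => hG _ _)
      (fun _ _ => hG' _ _) fun _ _ => h _ _
    have h0 := ih (fun n m => G n (m + 1)) (fun n m => G' n (m + 1)) (fun _ _ => hG _ _)
      (fun _ _ => hG' _ _) fun _ _ => h _ _
    have hd := stackPlays_le_one_add R G' hG'
    have b := hG 0 0
    have hh := h 0 0
    simp only [stackPlays]
    nlinarith

/-! ### Plays of the adaptive sampling scheme -/

/-- The counts contributed by a single trial. -/
def trialCounts (x : Bool) : ℕ × ℕ := cond x (1, 0) (0, 1)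

/-- The counts after arm `j` is played with trial outcome `x`. -/
def record (c : Counts) (j : Fin 2) (x : Bool) : Counts := c + Pi.single j (trialCounts x)

/-- The numbers of successes and failures in a list of trials. -/
def tally (l : List Bool) : ℕ × ℕ := (l.count true, l.count false)

lemma tally_cons (x : Bool) (l : List Bool) : tally (x :: l) = trialCounts x + tally l := by
  cases x <;> simp [tally, trialCounts, add_comm]

/-- The expected number of plays of arm `1` in the next `R` rounds from the counts `c`, if arm `1`
is played with probability `g c` and arm `j` has success probability `p j`. -/
def expectedPlays (g : Counts → ℝ) (p : Fin 2 → ℝ) : ℕ → Counts → ℝ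
  | 0, _ => 0
  | R + 1, c => g c * (1 + bernoulliMean (p 1) fun x => expectedPlays g p R (record c 1 x)) +
      (1 - g c) * bernoulliMean (p 0) fun x => expectedPlays g p R (record c 0 x)

/-- The probability of playing arm `1` when the trials of arms `1` and `0` after the counts `c`
have the outcomes `l₁` and `l₀`. -/
def stackPolicy (g : Counts → ℝ) (c : Counts) (l₁ l₀ : List Bool) (n m : ℕ) : ℝ :=
  g (c + Pi.single 1 (tally (l₁.take n)) + Pi.single 0 (tally (l₀.take m)))

/-- Using up the top of a stack amounts to recording it in the counts; this matches the recursion of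
`stackPlays` with that of `expectedPlays`. -/
lemma stackPolicy_cons_one (g : Counts → ℝ) (c : Counts) (x : Bool) (l₁ l₀ : List Bool) :
    (fun n m => stackPolicy g c (x :: l₁) l₀ (n + 1) m) =
      stackPolicy g (record c 1 x) l₁ l₀ := by
  funext n m
  simp only [stackPolicy, List.take_succ_cons, tally_cons, record, Pi.single_add]
  congr 1
  abel

lemma stackPolicy_cons_zero (g : Counts → ℝ) (c : Counts) (x : Bool) (l₁ l₀ : List Bool) :
    (fun n m => stackPolicy g c l₁ (x :: l₀) n (m + 1)) =
      stackPolicy g (record c 0 x) l₁ l₀ := by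
  funext n m
  simp only [stackPolicy, List.take_succ_cons, tally_cons, record, Pi.single_add]
  congr 1
  abel

/-- Drawing all the trials of both arms in advance does not change the expected number of
plays. -/
lemma expectedPlays_eq_stackMean (g : Counts → ℝ) (p : Fin 2 → ℝ) (R : ℕ) (c : Counts)
    (n m : ℕ) (hn : R ≤ n) (hm : R ≤ m) :
    expectedPlays g p R c = stackMean (p 1) n fun l₁ => stackMean (p 0) m fun l₀ =>
      stackPlays R (stackPolicy g c l₁ l₀) := by
  induction R generalizing c n m with
  | zero =>
    have h (q : ℝ) (n : ℕ) : stackMean q n (fun _ => 0) = 0 := by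
      simpa using stackMean_affine q n 0 0 0 (fun _ => 0) fun _ => 0
    simp [expectedPlays, stackPlays, h]
  | succ R ih =>
    obtain ⟨n, rfl⟩ := Nat.exists_eq_add_of_le' (show 1 ≤ n by omega)
    obtain ⟨m, rfl⟩ := Nat.exists_eq_add_of_le' (show 1 ≤ m by omega)
    have h00 (l₁ l₀ : List Bool) : stackPolicy g c l₁ l₀ 0 0 = g c := by
      simp [stackPolicy, tally, ← Prod.zero_eq_mk]
    simp only [stackPlays, h00, stackMean_affine, expectedPlays]
    refine congrArg₂ (· + ·) (congrArg (fun y => g c * (1 + y)) ?_)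
      (congrArg (fun y => (1 - g c) * y) ?_)
    -- Only the stack of the arm that is played gets shorter, so the two lengths must vary
    -- independently in the induction.
    · simp only [stackMean, stackPolicy_cons_one]
      congr 1
      funext x
      rw [ih (record c 1 x) n (m + 1) (by omega) (by omega)]
      rfl
    · have e (l₁ : List Bool) : (stackMean (p 0) (m + 1) fun l₀ =>
          stackPlays R fun n m => stackPolicy g c l₁ l₀ n (m + 1)) =
          bernoulliMean (p 0) fun x => stackMean (p 0) m fun l₀ =>
            stackPlays R (stackPolicy g (record c 0 x) l₁ l₀) := by
        simp only [stackMean, stackPolicy_cons_zero]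
      -- The top of the stack of arm `0` is averaged inside the mean over `l₁` and has to be moved
      -- outside.
      simp only [e, stackMean_bernoulliMean]
      congr 1
      funext x
      exact ih (record c 0 x) (n + 1) m (by omega) (by omega)

/-- The policy `g` favours arm `1` the more successes it has among a given number of its trials,
and the fewer successes arm `0` has. -/
def MonotonePolicy (g : Counts → ℝ) : Prop :=
  ∀ c c' : Counts, (c 1).1 ≤ (c' 1).1 → (c 1).1 + (c 1).2 = (c' 1).1 + (c' 1).2 →
    (c' 0).1 ≤ (c 0).1 → (c 0).1 + (c 0).2 = (c' 0).1 + (c' 0).2 → g c ≤ g c'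

lemma tally_le_of_forall₂ {l l' : List Bool} (h : List.Forall₂ (· ≤ ·) l l') :
    (tally l).1 ≤ (tally l').1 ∧ (tally l).1 + (tally l).2 = (tally l').1 + (tally l').2 := by
  induction h with
  | nil => simp
  | @cons x y l l' hxy _ ih =>
    simp only [tally] at ih ⊢
    have hxy' : ¬(x = true ∧ y = false) := by
      rintro ⟨rfl, rfl⟩
      exact absurd hxy (by decide)
    cases x <;> cases y <;> simp at hxy' ⊢ <;> omega

lemma stackPolicy_mono {g : Counts → ℝ} (hg : MonotonePolicy g) (c : Counts)
    {l₁ l₁' l₀ l₀' : List Bool} (h₁ : List.Forall₂ (· ≤ ·) l₁ l₁')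
    (h₀ : List.Forall₂ (· ≤ ·) l₀' l₀) (n m : ℕ) :
    stackPolicy g c l₁ l₀ n m ≤ stackPolicy g c l₁' l₀' n m := by
  have a₁ := tally_le_of_forall₂ (List.forall₂_take n h₁)
  have a₀ := tally_le_of_forall₂ (List.forall₂_take m h₀)
  apply hg <;> simp <;> omega

/-- The expected number of plays of arm `1` is increasing in the success probability of arm `1`
and decreasing in that of arm `0`. -/
theorem expectedPlays_mono_param {g : Counts → ℝ} (hg : MonotonePolicy g)
    (hg01 : ∀ c, 0 ≤ g c ∧ g c ≤ 1) {p p' : Fin 2 → ℝ} (hp : ∀ i, 0 ≤ p i ∧ p i ≤ 1)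
    (hp' : ∀ i, 0 ≤ p' i ∧ p' i ≤ 1) (h₁ : p 1 ≤ p' 1) (h₀ : p' 0 ≤ p 0) (R : ℕ) (c : Counts) :
    expectedPlays g p R c ≤ expectedPlays g p' R c := by
  rw [expectedPlays_eq_stackMean g p R c R R le_rfl le_rfl,
    expectedPlays_eq_stackMean g p' R c R R le_rfl le_rfl]
  have mono {l₁ l₁' l₀ l₀' : List Bool} (h₁ : List.Forall₂ (· ≤ ·) l₁ l₁')
      (h₀ : List.Forall₂ (· ≤ ·) l₀' l₀) :
      stackPlays R (stackPolicy g c l₁ l₀) ≤ stackPlays R (stackPolicy g c l₁' l₀') :=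
    stackPlays_mono R _ _ (fun _ _ => hg01 _) (fun _ _ => hg01 _) (stackPolicy_mono hg c h₁ h₀)
  refine (stackMean_mono_param (hp 1).1 h₁ (hp' 1).2 R fun l₁ l₁' hl =>
    stackMean_mono (hp 0).1 (hp 0).2 R fun l₀ => mono hl (List.forall₂_refl l₀)).trans ?_
  refine stackMean_mono (hp' 1).1 (hp' 1).2 R fun l₁ => ?_
  -- The plays of arm `1` decrease in the outcomes of arm `0`, so `stackMean_mono_param` is applied
  -- to their negative.
  rw [← neg_le_neg_iff, ← stackMean_neg, ← stackMean_neg]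
  exact stackMean_mono_param (hp' 0).1 h₀ (hp 0).2 R fun l₀ l₀' hl =>
    neg_le_neg (mono (List.forall₂_refl l₁) hl)

/-- Relabelling the arms turns the plays of arm `1` into those of arm `0`. -/
lemma expectedPlays_add_swap {g : Counts → ℝ} (hg : ∀ c, g c + g (c ∘ Equiv.swap 0 1) = 1)
    (p : Fin 2 → ℝ) (R : ℕ) (c : Counts) :
    expectedPlays g p R c + expectedPlays g (p ∘ Equiv.swap 0 1) R (c ∘ Equiv.swap 0 1) = R := by
  induction R generalizing c with
  | zero => simp [expectedPlays]
  | succ R ih =>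
    have rec_swap (j : Fin 2) (x : Bool) : record (c ∘ Equiv.swap 0 1) j x =
        record c (Equiv.swap 0 1 j) x ∘ Equiv.swap 0 1 := by
      funext i
      fin_cases i <;> fin_cases j <;> simp [record]
    have e (j : Fin 2) (x : Bool) := eq_sub_of_add_eq' (ih (record c j x))
    simp only [expectedPlays, rec_swap, Equiv.swap_apply_left, Equiv.swap_apply_right,
      Function.comp_apply, e, eq_sub_of_add_eq' (hg c), bernoulliMean]
    push_cast
    ring

/-- The arm with the larger success probability gets at least half of the plays. -/
theorem half_le_expectedPlays {g : Counts → ℝ} (hg : MonotonePolicy g)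
    (hg01 : ∀ c, 0 ≤ g c ∧ g c ≤ 1) (hswap : ∀ c, g c + g (c ∘ Equiv.swap 0 1) = 1)
    {p : Fin 2 → ℝ} (hp : ∀ i, 0 ≤ p i ∧ p i ≤ 1) (h : p 0 ≤ p 1) (R : ℕ) :
    (R : ℝ) / 2 ≤ expectedPlays g p R 0 := by
  -- From the symmetric counts `0`, the values for `p` and for the exchanged probabilities sum to
  -- `R`, and the one for `p` is the larger.
  have hs := expectedPlays_add_swap hswap p R 0
  have hm := expectedPlays_mono_param hg hg01 (p := p ∘ Equiv.swap 0 1) (p' := p)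
    (fun i => hp _) hp (by simpa using h) (by simpa using h) R 0
  rw [show (0 : Counts) ∘ Equiv.swap 0 1 = 0 from rfl] at hs
  linarith

/-- `expectedPlays` counts plays of arm `1` only; this is the version for when arm `0` is the better
one. -/
theorem expectedPlays_le_half {g : Counts → ℝ} (hg : MonotonePolicy g)
    (hg01 : ∀ c, 0 ≤ g c ∧ g c ≤ 1) (hswap : ∀ c, g c + g (c ∘ Equiv.swap 0 1) = 1)
    {p : Fin 2 → ℝ} (hp : ∀ i, 0 ≤ p i ∧ p i ≤ 1) (h : p 1 ≤ p 0) (R : ℕ) :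
    expectedPlays g p R 0 ≤ (R : ℝ) / 2 := by
  have hs := expectedPlays_add_swap hswap p R 0
  have hm := expectedPlays_mono_param hg hg01 (p := p) (p' := p ∘ Equiv.swap 0 1)
    hp (fun i => hp _) (by simpa using h) (by simpa using h) R 0
  rw [show (0 : Counts) ∘ Equiv.swap 0 1 = 0 from rfl] at hs
  linarith

/-! ### Stochastic order of Beta distributions -/

instance nullSingletonClass_betaMeasure (a b : ℝ) : NullSingletonClass (betaMeasure a b) := by
  unfold betaMeasure; infer_instance

instance isProbabilityMeasure_betaMeasure_nat (s f : ℕ) :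
    IsProbabilityMeasure (betaMeasure (s + 1) (f + 1)) :=
  isProbabilityMeasureBeta (by positivity) (by positivity)

/-- If the density `f'` is at most a multiple of `f` below the threshold and at least the same
multiple of `f` above it, then `f'` has the heavier upper tail. -/
lemma withDensity_Ioi_le_of_ratio {f f' : ℝ → ENNReal}
    [IsProbabilityMeasure (volume.withDensity f)] [IsProbabilityMeasure (volume.withDensity f')]
    (t : ℝ) (κ : ENNReal) (hle : ∀ x ≤ t, f' x ≤ κ * f x) (hge : ∀ x, t < x → κ * f x ≤ f' x) :
    volume.withDensity f (Set.Ioi t) ≤ volume.withDensity f' (Set.Ioi t) := by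
  -- For `κ ≥ 1` the upper tails compare directly; for `κ ≤ 1` the lower tails do, and both total
  -- masses are `1`.
  rcases le_total 1 κ with h | h
  · rw [withDensity_apply _ measurableSet_Ioi, withDensity_apply _ measurableSet_Ioi]
    refine setLIntegral_mono' measurableSet_Ioi fun x hx => le_trans ?_ (hge x hx)
    exact le_mul_of_one_le_left' h
  · have : volume.withDensity f' (Set.Iic t) ≤ volume.withDensity f (Set.Iic t) := by
      rw [withDensity_apply _ measurableSet_Iic, withDensity_apply _ measurableSet_Iic]
      refine setLIntegral_mono' measurableSet_Iic fun x hx => (hle x hx).trans ?_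
      exact mul_le_of_le_one_left' h
    rw [← Set.compl_Iic, prob_compl_eq_one_sub measurableSet_Iic,
      prob_compl_eq_one_sub measurableSet_Iic]
    exact tsub_le_tsub_left this 1

/-- Turning a failure into a success makes the Beta distribution stochastically larger. -/
lemma betaMeasure_Ioi_le_succ (s f : ℕ) (t : ℝ) :
    betaMeasure (s + 1) ((f + 1 : ℕ) + 1) (Set.Ioi t) ≤
      betaMeasure ((s + 1 : ℕ) + 1) (f + 1) (Set.Ioi t) := by
  rcases le_or_gt 1 t with ht1 | ht1
  · refine le_of_eq_of_le ?_ zero_le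
    rw [betaMeasure, withDensity_apply _ measurableSet_Ioi]
    exact setLIntegral_eq_zero measurableSet_Ioi fun x hx =>
      betaPDF_eq_zero_of_one_le (ht1.trans (Set.mem_Ioi.1 hx).le)
  rcases le_or_gt t 0 with ht0 | ht0
  · refine prob_le_one.trans_eq ?_
    have : betaMeasure ((s + 1 : ℕ) + 1) (f + 1) (Set.Iic t) = 0 := by
      rw [betaMeasure, withDensity_apply _ measurableSet_Iic]
      exact setLIntegral_eq_zero measurableSet_Iic fun x hx =>
        betaPDF_eq_zero_of_nonpos ((Set.mem_Iic.1 hx).trans ht0)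
    rw [← Set.compl_Iic, prob_compl_eq_one_sub measurableSet_Iic, this, tsub_zero]
  set B := beta (s + 1) ((f + 1 : ℕ) + 1)
  set B' := beta ((s + 1 : ℕ) + 1) (f + 1)
  have hBpos : 0 < B := beta_pos (by positivity) (by positivity)
  have hBpos' : 0 < B' := beta_pos (by positivity) (by positivity)
  have pdf (x : ℝ) (hx : 0 < x ∧ x < 1) :
      betaPDFReal (s + 1) ((f + 1 : ℕ) + 1) x = 1 / B * x ^ s * (1 - x) ^ f * (1 - x) := by
    rw [betaPDFReal, if_pos hx, add_sub_cancel_right, add_sub_cancel_right, Real.rpow_natCast,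
      Real.rpow_natCast, pow_succ]
    ring
  have pdf' (x : ℝ) (hx : 0 < x ∧ x < 1) :
      betaPDFReal ((s + 1 : ℕ) + 1) (f + 1) x = 1 / B' * x ^ s * (1 - x) ^ f * x := by
    rw [betaPDFReal, if_pos hx, add_sub_cancel_right, add_sub_cancel_right, Real.rpow_natCast,
      Real.rpow_natCast, pow_succ]
    ring
  have hs : 0 < 1 - t := sub_pos.2 ht1
  -- The quotient of the densities is `B / B' * (x / (1 - x))`, increasing in `x`. The multiple `κ`
  -- is its value at `t`, so the difference has the sign of `x - t`.
  have ratio (x : ℝ) (hx : 0 < x ∧ x < 1) : betaPDFReal ((s + 1 : ℕ) + 1) (f + 1) x -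
      B / B' * (t / (1 - t)) * betaPDFReal (s + 1) ((f + 1 : ℕ) + 1) x =
      1 / B' * x ^ s * (1 - x) ^ f / (1 - t) * (x - t) := by
    rw [pdf x hx, pdf' x hx]
    field_simp
    ring
  have hc (x : ℝ) (hx : 0 < x ∧ x < 1) : 0 ≤ 1 / B' * x ^ s * (1 - x) ^ f / (1 - t) := by
    have := hx.1.le
    have := sub_pos.2 hx.2
    positivity
  have : IsProbabilityMeasure (volume.withDensity (betaPDF (s + 1) ((f + 1 : ℕ) + 1))) :=
    isProbabilityMeasure_betaMeasure_nat s (f + 1)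
  have : IsProbabilityMeasure (volume.withDensity (betaPDF ((s + 1 : ℕ) + 1) (f + 1))) :=
    isProbabilityMeasure_betaMeasure_nat (s + 1) f
  have hκ : 0 ≤ B / B' * (t / (1 - t)) := by positivity
  refine withDensity_Ioi_le_of_ratio t (ENNReal.ofReal (B / B' * (t / (1 - t)))) ?_ ?_
  · intro x hxt
    rcases le_or_gt x 0 with hx | hx
    · simp [betaPDF_eq_zero_of_nonpos hx]
    rw [betaPDF, betaPDF, ← ENNReal.ofReal_mul hκ]
    have hx' : 0 < x ∧ x < 1 := ⟨hx, hxt.trans_lt ht1⟩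
    refine ENNReal.ofReal_le_ofReal (sub_nonpos.1 ?_)
    rw [ratio x hx']
    exact mul_nonpos_of_nonneg_of_nonpos (hc x hx') (sub_nonpos.2 hxt)
  · intro x hxt
    rcases le_or_gt 1 x with hx | hx
    · simp [betaPDF_eq_zero_of_one_le hx]
    rw [betaPDF, betaPDF, ← ENNReal.ofReal_mul hκ]
    have hx' : 0 < x ∧ x < 1 := ⟨ht0.trans hxt, hx⟩
    refine ENNReal.ofReal_le_ofReal (sub_nonneg.1 ?_)
    rw [ratio x hx']
    exact mul_nonneg (hc x hx') (sub_nonneg.2 hxt.le)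

lemma betaMeasure_Ioi_le {s f s' f' : ℕ} (hs : s ≤ s') (h : s + f = s' + f') (t : ℝ) :
    betaMeasure (s + 1) (f + 1) (Set.Ioi t) ≤ betaMeasure (s' + 1) (f' + 1) (Set.Ioi t) := by
  induction s', hs using Nat.le_induction generalizing f' with
  | base => rw [show f = f' by omega]
  | succ s' hs ih => exact (ih (f' := f' + 1) (by omega)).trans (betaMeasure_Ioi_le_succ s' f' t)

lemma betaMeasure_Iio_le {s f s' f' : ℕ} (hs : s ≤ s') (h : s + f = s' + f') (t : ℝ) :
    betaMeasure (s' + 1) (f' + 1) (Set.Iio t) ≤ betaMeasure (s + 1) (f + 1) (Set.Iio t) := by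
  rw [measure_congr Iio_ae_eq_Iic, measure_congr Iio_ae_eq_Iic, ← Set.compl_Ioi,
    prob_compl_eq_one_sub measurableSet_Ioi, prob_compl_eq_one_sub measurableSet_Ioi]
  exact tsub_le_tsub_left (betaMeasure_Ioi_le hs h t) 1

/-! ### The probability of playing arm `1` -/

/-- The probability that arm `1` has the larger posterior sample. -/
def playProb (c : Counts) : ℝ := (posterior c).real {θ | argmaxArm θ = 1}

lemma setOf_argmaxArm_eq_one : {θ | argmaxArm θ = 1} = {θ : Fin 2 → ℝ | θ 0 < θ 1} := by
  ext θ
  simp [argmaxArm]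

lemma setOf_argmaxArm_eq_zero : {θ | argmaxArm θ = 0} = {θ | argmaxArm θ = 1}ᶜ := by
  ext θ
  simp [argmaxArm]

lemma measurableSet_argmaxArm (j : Fin 2) : MeasurableSet {θ | argmaxArm θ = j} :=
  measurable_argmaxArm (measurableSet_singleton j)

lemma posterior_real_argmaxArm_zero (c : Counts) :
    (posterior c).real {θ | argmaxArm θ = 0} = 1 - playProb c := by
  rw [setOf_argmaxArm_eq_zero, probReal_compl_eq_one_sub (measurableSet_argmaxArm 1), playProb]

/-- The Beta posterior of an arm with `n.1` successes and `n.2` failures. -/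
abbrev armPosterior (n : ℕ × ℕ) : Measure ℝ := betaMeasure (n.1 + 1) (n.2 + 1)

lemma posterior_preimage_prod (c : Counts) {A : Set (ℝ × ℝ)} (hA : MeasurableSet A) :
    posterior c {θ | (θ 0, θ 1) ∈ A} = (armPosterior (c 0)).prod (armPosterior (c 1)) A :=
  (measurePreserving_piFinTwo fun j => armPosterior (c j)).measure_preimage hA.nullMeasurableSet

lemma posterior_argmaxArm_one (c : Counts) : posterior c {θ | argmaxArm θ = 1} =
    (armPosterior (c 0)).prod (armPosterior (c 1)) {x | x.1 < x.2} := by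
  rw [setOf_argmaxArm_eq_one]
  exact posterior_preimage_prod c (measurableSet_lt measurable_fst measurable_snd)

lemma playProb_mem (c : Counts) : 0 ≤ playProb c ∧ playProb c ≤ 1 :=
  ⟨measureReal_nonneg, measureReal_le_one⟩

/-- The samples are independent, so one posterior can be changed at a time: given the other sample,
the event is an upper tail for arm `1` or a lower tail for arm `0`. -/
lemma monotonePolicy_playProb : MonotonePolicy playProb := by
  intro c c' h1 h1' h0 h0'
  have hm : MeasurableSet {x : ℝ × ℝ | x.1 < x.2} := measurableSet_lt measurable_fst measurable_snd
  refine ENNReal.toReal_mono (measure_ne_top _ _) ?_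
  rw [posterior_argmaxArm_one, posterior_argmaxArm_one]
  calc (armPosterior (c 0)).prod (armPosterior (c 1)) {x | x.1 < x.2}
      ≤ (armPosterior (c 0)).prod (armPosterior (c' 1)) {x | x.1 < x.2} := by
        rw [Measure.prod_apply hm, Measure.prod_apply hm]
        exact lintegral_mono fun x => betaMeasure_Ioi_le h1 h1' x
    _ ≤ (armPosterior (c' 0)).prod (armPosterior (c' 1)) {x | x.1 < x.2} := by
        rw [Measure.prod_apply_symm hm, Measure.prod_apply_symm hm]
        exact lintegral_mono fun x => betaMeasure_Iio_le h0 h0'.symm x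

/-- The tie-breaking rule favours arm `0`, but the posteriors have no atoms, so ties are null and
the arms are exchangeable. -/
lemma playProb_add_swap (c : Counts) : playProb c + playProb (c ∘ Equiv.swap 0 1) = 1 := by
  have hm : MeasurableSet {x : ℝ × ℝ | x.1 < x.2} := measurableSet_lt measurable_fst measurable_snd
  have swapped : posterior (c ∘ Equiv.swap 0 1) {θ | argmaxArm θ = 1} =
      (armPosterior (c 0)).prod (armPosterior (c 1)) {x | x.2 < x.1} := by
    rw [posterior_argmaxArm_one, ← Measure.prod_swap, Measure.map_apply measurable_swap hm]
    simp only [Function.comp_apply, Equiv.swap_apply_left, Equiv.swap_apply_right]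
    rfl
  have tie : (armPosterior (c 0)).prod (armPosterior (c 1)) {x | x.1 = x.2} = 0 := by
    rw [Measure.prod_apply (measurableSet_eq_fun measurable_fst measurable_snd)]
    refine (lintegral_congr fun x => ?_).trans lintegral_zero
    have : Prod.mk x ⁻¹' {x : ℝ × ℝ | x.1 = x.2} = {x} := by
      ext y
      simp [eq_comm]
    rw [this, measure_singleton]
  have compl : (armPosterior (c 0)).prod (armPosterior (c 1)) {x | x.2 < x.1} =
      (armPosterior (c 0)).prod (armPosterior (c 1)) {x | x.1 < x.2}ᶜ := by
    refine le_antisymm (measure_mono fun x (hx : x.2 < x.1) => ?_) ?_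
    · simpa using hx.le
    · have : {x : ℝ × ℝ | x.1 < x.2}ᶜ ⊆ {x | x.2 < x.1} ∪ {x | x.1 = x.2} := by
        intro x hx
        simpa [le_iff_lt_or_eq, eq_comm] using hx
      refine (measure_mono this).trans ((measure_union_le _ _).trans ?_)
      rw [tie, add_zero]
  rw [playProb, playProb, measureReal_def, measureReal_def, swapped, compl,
    posterior_argmaxArm_one, ← measureReal_def, ← measureReal_def, probReal_compl_eq_one_sub hm]
  ring

/-! ### One round -/

/-- The probability that the trial of arm `j` is a success. -/
def successProb (ν : Fin 2 → Measure ℝ) (L U : ℝ) (j : Fin 2) : ℝ :=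
  ∫ r, (rescale L U r : ℝ) ∂ν j

lemma integrable_rescale (L U : ℝ) (ρ : Measure ℝ) [IsFiniteMeasure ρ] :
    Integrable (fun r => (rescale L U r : ℝ)) ρ :=
  Integrable.of_bound (measurable_subtype_coe.comp (measurable_rescale L U)).aestronglyMeasurable 1
    (.of_forall fun r => by
      rw [Real.norm_of_nonneg (rescale L U r).2.1]
      exact (rescale L U r).2.2)

lemma successProb_mem (ν : Fin 2 → Measure ℝ) [∀ i, IsProbabilityMeasure (ν i)] (L U : ℝ)
    (j : Fin 2) : 0 ≤ successProb ν L U j ∧ successProb ν L U j ≤ 1 := by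
  refine ⟨integral_nonneg fun r => (rescale L U r).2.1, ?_⟩
  refine (integral_mono (integrable_rescale L U (ν j)) (integrable_const 1)
    fun r => (rescale L U r).2.2).trans_eq ?_
  simp

/-- The mean of a trial is affine in its success probability, so averaging over the reward gives a
trial with the averaged probability. -/
lemma integral_trial (ρ : Measure ℝ) [IsProbabilityMeasure ρ] (L U : ℝ) (H : Bool → ℝ) :
    ∫ q, H q.2 ∂(ρ ⊗ₘ trialKernel L U) = bernoulliMean (∫ r, (rescale L U r : ℝ) ∂ρ) H := by
  have hH : Integrable (fun q : ℝ × Bool => H q.2) (ρ ⊗ₘ trialKernel L U) :=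
    (Integrable.of_finite (f := H)).comp_measurable measurable_snd
  rw [Measure.integral_compProd hH]
  have (r : ℝ) : ∫ x, H x ∂trialKernel L U r = bernoulliMean (rescale L U r) H := by
    change ∫ x, H x ∂bernoulliMeasure true false (rescale L U r) = _
    simp [integral_bernoulliMeasure, bernoulliMean]
  simp only [this, bernoulliMean]
  have hi := integrable_rescale L U ρ
  have hi' : Integrable (fun r => 1 - (rescale L U r : ℝ)) ρ := (integrable_const 1).sub hi
  rw [integral_add (hi.mul_const _) (hi'.mul_const _),
    integral_mul_const, integral_mul_const, integral_sub (integrable_const 1) hi]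
  simp

/-- The mean of `H` at the arm played and the trial outcome, when arm `1` is played with
probability `a` and arm `j` has success probability `p j`. -/
def roundMean (a : ℝ) (p : Fin 2 → ℝ) (H : Fin 2 → Bool → ℝ) : ℝ :=
  a * bernoulliMean (p 1) (H 1) + (1 - a) * bernoulliMean (p 0) (H 0)

lemma measurable_arm_outcome :
    Measurable fun r : Round => (argmaxArm r.1, r.2.2) :=
  (measurable_argmaxArm.comp measurable_fst).prodMk (measurable_snd.comp measurable_snd)

lemma integral_roundKernel (ν : Fin 2 → Measure ℝ) [∀ i, IsProbabilityMeasure (ν i)] (L U : ℝ)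
    (c : Counts) (H : Fin 2 → Bool → ℝ) :
    ∫ r, H (argmaxArm r.1) r.2.2 ∂roundKernel ν L U c =
      roundMean (playProb c) (successProb ν L U) H := by
  change ∫ r, H (argmaxArm r.1) r.2.2 ∂(posterior c ⊗ₘ
    (playKernel ν L U).comap argmaxArm measurable_argmaxArm) = _
  have hH : Integrable (fun r : Round => H (argmaxArm r.1) r.2.2) (posterior c ⊗ₘ
      (playKernel ν L U).comap argmaxArm measurable_argmaxArm) :=
    (Integrable.of_finite (f := fun q : Fin 2 × Bool => H q.1 q.2)).comp_measurable
      measurable_arm_outcome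
  rw [Measure.integral_compProd hH]
  have inner (θ : Fin 2 → ℝ) : ∫ q, H (argmaxArm θ) q.2
      ∂((playKernel ν L U).comap argmaxArm measurable_argmaxArm θ) =
      bernoulliMean (successProb ν L U (argmaxArm θ)) (H (argmaxArm θ)) :=
    integral_trial (ν (argmaxArm θ)) L U (H (argmaxArm θ))
  simp only [inner]
  rw [← integral_map (φ := argmaxArm)
      (f := fun j => bernoulliMean (successProb ν L U j) (H j))
      measurable_argmaxArm.aemeasurable .of_discrete,
    integral_fintype .of_finite, Fin.sum_univ_two,
    map_measureReal_apply measurable_argmaxArm (measurableSet_singleton _),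
    map_measureReal_apply measurable_argmaxArm (measurableSet_singleton _),
    smul_eq_mul, smul_eq_mul, add_comm]
  exact congrArg₂ (· + ·) rfl (congrArg (· * _) (posterior_real_argmaxArm_zero c))

/-! ### The trajectory of the counts -/

/-- The counts after the first `t` rounds of `ω`. -/
def runCounts (ω : ℕ → Round) : ℕ → Counts
  | 0 => 0
  | t + 1 => record (runCounts ω t) (argmaxArm (ω t).1) (ω t).2.2

lemma runCounts_eq_sum (ω : ℕ → Round) (t : ℕ) (j : Fin 2) : runCounts ω t j =
    (∑ i ∈ Finset.range t, if argmaxArm (ω i).1 = j ∧ (ω i).2.2 = true then 1 else 0,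
      ∑ i ∈ Finset.range t, if argmaxArm (ω i).1 = j ∧ (ω i).2.2 = false then 1 else 0) := by
  induction t with
  | zero => rfl
  | succ t ih =>
    rw [Finset.sum_range_succ, Finset.sum_range_succ, runCounts, record, Pi.add_apply, ih,
      ← Prod.mk_add_mk, Pi.single_apply]
    congr 1
    by_cases hj : argmaxArm (ω t).1 = j
    · cases h : (ω t).2.2 <;> simp [hj, trialCounts]
    · simp [hj, Ne.symm hj, ← Prod.zero_eq_mk]

/-- The history up to index `n` holds `n + 1` rounds. This links the counts used by the kernel to
the recursive `runCounts`. -/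
lemma counts_frestrictLe (ω : ℕ → Round) (n : ℕ) :
    counts (Preorder.frestrictLe (π := fun _ => Round) n ω) = runCounts ω (n + 1) := by
  funext j
  have hr : Finset.range (n + 1) = Finset.Iic n := by
    ext i
    simp
  rw [runCounts_eq_sum, hr]
  simp only [counts, countOutcome]
  exact congrArg₂ Prod.mk (Finset.sum_coe_sort (Finset.Iic n) fun i =>
      if argmaxArm (ω i).1 = j ∧ (ω i).2.2 = true then 1 else 0)
    (Finset.sum_coe_sort (Finset.Iic n) fun i =>
      if argmaxArm (ω i).1 = j ∧ (ω i).2.2 = false then 1 else 0)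

lemma measurable_record : Measurable fun q : Counts × Fin 2 × Bool => record q.1 q.2.1 q.2.2 :=
  .of_discrete

lemma measurable_runCounts (t : ℕ) : Measurable fun ω => runCounts ω t := by
  induction t with
  | zero => exact measurable_const
  | succ t ih =>
    exact measurable_record.comp
      (ih.prodMk (measurable_arm_outcome.comp (measurable_pi_apply t)))

variable (ν : Fin 2 → Measure ℝ) [∀ i, IsProbabilityMeasure (ν i)] (L U : ℝ)

instance : IsProbabilityMeasure (law ν L U) := by
  unfold law; infer_instance

lemma map_eval_zero_law : (law ν L U).map (fun ω => ω 0) = roundKernel ν L U 0 := by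
  have hf : (fun ω : ℕ → Round => ω 0) =
      (fun x : (i : Finset.Iic 0) → Round => x default) ∘
        Preorder.frestrictLe (π := fun _ => Round) 0 := rfl
  have he : Measurable fun x : (i : Finset.Iic 0) → Round => x default := measurable_pi_apply _
  rw [hf, ← Measure.map_map he (Preorder.measurable_frestrictLe 0),
    law, Kernel.trajMeasure, Measure.map_comp _ _ (Preorder.measurable_frestrictLe 0),
    Kernel.traj_map_frestrictLe, Kernel.partialTraj_self, Measure.id_comp,
    Measure.map_map he (MeasurableEquiv.measurable _)]
  exact Measure.map_id

/-- The law of round `t` given the past is that of one round from the current counts. -/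
lemma integral_law_round (t : ℕ) (F : Counts → Fin 2 → Bool → ℝ) (C : ℝ)
    (hF : ∀ c j x, |F c j x| ≤ C) :
    ∫ ω, F (runCounts ω t) (argmaxArm (ω t).1) (ω t).2.2 ∂law ν L U =
      ∫ ω, roundMean (playProb (runCounts ω t)) (successProb ν L U) (F (runCounts ω t))
        ∂law ν L U := by
  have hF' : Measurable fun q : Counts × Fin 2 × Bool => F q.1 q.2.1 q.2.2 := .of_discrete
  -- Round `0` has the initial law of the trajectory; each later round is drawn by the kernel from
  -- the history before it.
  cases t with
  | zero =>
    simp only [runCounts, integral_const, probReal_univ, one_smul]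
    rw [← integral_roundKernel, ← map_eval_zero_law, integral_map
      (measurable_pi_apply 0).aemeasurable]
    exact (hF'.comp (measurable_const.prodMk measurable_arm_outcome)).aestronglyMeasurable
  | succ n =>
    have hm : Measurable fun q : ((i : Finset.Iic n) → Round) × Round =>
        F (counts q.1) (argmaxArm q.2.1) q.2.2.2 :=
      hF'.comp ((measurable_counts.comp measurable_fst).prodMk
        (measurable_arm_outcome.comp measurable_snd))
    have hfr := Preorder.measurable_frestrictLe (X := fun _ : ℕ => Round) n
    have hmap := Kernel.map_frestrictLe_trajMeasure_compProd_eq_map_trajMeasure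
      (X := fun _ => Round) (μ₀ := roundKernel ν L U 0)
      (κ := fun _ => (roundKernel ν L U).comap counts measurable_counts) (a := n)
    change (law ν L U).map _ ⊗ₘ _ = (law ν L U).map _ at hmap
    have hprob : IsProbabilityMeasure
        ((law ν L U).map (Preorder.frestrictLe (π := fun _ => Round) n)) :=
      Measure.isProbabilityMeasure_map hfr.aemeasurable
    simp only [← counts_frestrictLe]
    rw [← integral_map (φ := fun ω => (Preorder.frestrictLe (π := fun _ => Round) n ω, ω (n + 1)))
      (f := fun q => F (counts q.1) (argmaxArm q.2.1) q.2.2.2)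
      (hfr.prodMk (measurable_pi_apply _)).aemeasurable hm.aestronglyMeasurable, ← hmap,
      Measure.integral_compProd
        (Integrable.of_bound hm.aestronglyMeasurable C (.of_forall fun q => hF _ _ _))]
    simp only [Kernel.comap_apply, integral_roundKernel]
    rw [integral_map hfr.aemeasurable]
    exact ((Measurable.of_discrete (f := fun c : Counts =>
      roundMean (playProb c) (successProb ν L U) (F c))).comp
        measurable_counts).aestronglyMeasurable

/-! ### The mean number of plays -/

lemma abs_expectedPlays_le {g : Counts → ℝ} (hg : ∀ c, 0 ≤ g c ∧ g c ≤ 1) {p : Fin 2 → ℝ}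
    (hp : ∀ i, 0 ≤ p i ∧ p i ≤ 1) (R : ℕ) (c : Counts) : |expectedPlays g p R c| ≤ R := by
  suffices h : 0 ≤ expectedPlays g p R c ∧ expectedPlays g p R c ≤ R by
    rw [abs_of_nonneg h.1]; exact h.2
  induction R generalizing c with
  | zero => simp [expectedPlays]
  | succ R ih =>
    have hb (j : Fin 2) : 0 ≤ bernoulliMean (p j) (fun x => expectedPlays g p R (record c j x)) ∧
        bernoulliMean (p j) (fun x => expectedPlays g p R (record c j x)) ≤ R := by
      have ht := ih (record c j true)
      have hf := ih (record c j false)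
      have := hp j
      simp only [bernoulliMean]
      constructor <;> nlinarith
    have h1 := hb 1
    have h0 := hb 0
    have := hg c
    simp only [expectedPlays]
    push_cast
    constructor <;> nlinarith

lemma plays_succ (k : Fin 2) (t : ℕ) (ω : ℕ → Round) :
    plays k (t + 1) ω = plays k t ω + if argmaxArm (ω t).1 = k then 1 else 0 := by
  simp only [plays, Finset.card_filter, Finset.sum_range_succ]

lemma plays_le (k : Fin 2) (T : ℕ) (ω : ℕ → Round) : plays k T ω ≤ T :=
  (Finset.card_filter_le _ _).trans (Finset.card_range T).le

lemma measurable_plays (k : Fin 2) (T : ℕ) : Measurable (plays k T) := by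
  induction T with
  | zero => exact measurable_const
  | succ T ih =>
    have : plays k (T + 1) = fun ω => plays k T ω + if argmaxArm (ω T).1 = k then 1 else 0 :=
      funext (plays_succ k T)
    rw [this]
    exact ih.add (Measurable.ite ((measurable_argmaxArm.comp (measurable_fst.comp
      (measurable_pi_apply T))) (measurableSet_singleton k)) measurable_const measurable_const)

lemma measurable_plays_cast (k : Fin 2) (T : ℕ) : Measurable fun ω => (plays k T ω : ℝ) :=
  measurable_from_nat.comp (measurable_plays k T)

lemma memLp_plays (k : Fin 2) (T : ℕ) (q : ENNReal) :
    MemLp (fun ω => (plays k T ω : ℝ)) q (law ν L U) :=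
  MemLp.of_bound (measurable_plays_cast k T).aestronglyMeasurable T
    (.of_forall fun ω => by simpa using plays_le k T ω)

/-- The number of plays of arm `1` so far plus the expected number of its plays in the remaining
rounds has constant mean. -/
lemma integral_plays_add (t R : ℕ) :
    ∫ ω, (plays 1 t ω : ℝ) ∂law ν L U +
      ∫ ω, expectedPlays playProb (successProb ν L U) R (runCounts ω t) ∂law ν L U =
      expectedPlays playProb (successProb ν L U) (t + R) 0 := by
  induction t generalizing R with
  | zero => simp [plays, runCounts]
  | succ t ih =>
    set V := expectedPlays playProb (successProb ν L U) with hV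
    have bound := abs_expectedPlays_le playProb_mem (successProb_mem ν L U)
    have hVint : Integrable (fun ω => V R (runCounts ω (t + 1))) (law ν L U) :=
      Integrable.of_bound ((Measurable.of_discrete (f := V R)).comp
        (measurable_runCounts (t + 1))).aestronglyMeasurable R (.of_forall fun ω => bound R _)
    have hp (T : ℕ) : Integrable (fun ω => (plays 1 T ω : ℝ)) (law ν L U) :=
      (memLp_plays ν L U 1 T 1).integrable le_rfl
    -- The integrand is the indicator of a play of arm `1` now plus the value after the round; its
    -- conditional mean is `V (R + 1)` by the recursion (`hmean`).
    have step := integral_law_round ν L U t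
      (fun c j x => (if j = 1 then 1 else 0) + V R (record c j x)) (1 + R) fun c j x => by
        refine (abs_add_le _ _).trans (add_le_add ?_ (bound R _))
        split_ifs <;> simp
    have hmean (c : Counts) : roundMean (playProb c) (successProb ν L U)
        (fun j x => (if j = 1 then 1 else 0) + V R (record c j x)) = V (R + 1) c := by
      simp only [roundMean, bernoulliMean, hV, expectedPlays]
      rw [if_pos trivial, if_neg zero_ne_one]
      ring
    simp only [hmean] at step
    rw [show t + 1 + R = t + (R + 1) by omega, ← ih (R + 1), ← step, ← integral_add (hp _) hVint,
      ← integral_add (hp t)]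
    · congr 1
      funext ω
      rw [plays_succ]
      push_cast
      rw [add_assoc]
      rfl
    · have h := (hp (t + 1)).sub (hp t) |>.add hVint
      refine h.congr (.of_forall fun ω => ?_)
      simp [plays_succ, runCounts]

theorem integral_plays_one (T : ℕ) : ∫ ω, (plays 1 T ω : ℝ) ∂law ν L U =
    expectedPlays playProb (successProb ν L U) T 0 := by
  simpa [expectedPlays] using integral_plays_add ν L U T 0

lemma plays_zero_add_plays_one (T : ℕ) (ω : ℕ → Round) : plays 0 T ω + plays 1 T ω = T := by
  induction T with
  | zero => rfl
  | succ T ih =>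
    rw [plays_succ, plays_succ]
    generalize argmaxArm (ω T).1 = j
    fin_cases j <;> simp <;> omega

/-- An arm whose trials succeed with the larger probability gets at least half of the plays in
the mean. -/
theorem half_le_integral_plays (k : Fin 2)
    (hk : ∀ i, successProb ν L U i ≤ successProb ν L U k) (T : ℕ) :
    (T : ℝ) / 2 ≤ ∫ ω, (plays k T ω : ℝ) ∂law ν L U := by
  have hp := successProb_mem ν L U
  fin_cases k
  · have h := expectedPlays_le_half monotonePolicy_playProb playProb_mem playProb_add_swap hp
      (hk 1) T
    have e (ω : ℕ → Round) : (plays 0 T ω : ℝ) = T - plays 1 T ω := by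
      rw [eq_sub_iff_add_eq]
      exact_mod_cast plays_zero_add_plays_one T ω
    simp only [Fin.zero_eta, e]
    rw [integral_sub (integrable_const _) ((memLp_plays ν L U 1 T 1).integrable le_rfl),
      integral_plays_one]
    simp only [integral_const, probReal_univ, one_smul]
    linarith
  · simp only [Fin.mk_one]
    rw [integral_plays_one]
    exact half_le_expectedPlays monotonePolicy_playProb playProb_mem playProb_add_swap hp (hk 0) T

/-! ### Success probabilities and means -/

lemma gaussianQ_zero : gaussianQ 0 = 1 / 2 := by
  have : NullSingletonClass (gaussianReal 0 1) := nullSingletonClass_gaussianReal one_ne_zero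
  have hneg : (gaussianReal 0 1).real (Set.Iio 0) = gaussianQ 0 := by
    have h : (gaussianReal 0 1).map (fun x => -x) = gaussianReal 0 1 := by
      rw [gaussianReal_map_neg, neg_zero]
    rw [gaussianQ]
    conv_rhs => rw [← h, map_measureReal_apply measurable_neg measurableSet_Ioi]
    congr 1
    ext x
    simp
  have hc := probReal_compl_eq_one_sub (μ := gaussianReal 0 1) (measurableSet_Ioi (a := (0 : ℝ)))
  rw [Set.compl_Ioi, ← measureReal_congr Iio_ae_eq_Iic, hneg] at hc
  change gaussianQ 0 = 1 - gaussianQ 0 at hc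
  linarith

/-- The tail is decreasing and equals `1 / 2` at `0`. This is what makes `L ≤ U` in the Gaussian
case. -/
lemma nonneg_of_gaussianQ_lt_half {q : ℝ} (h : gaussianQ q < 1 / 2) : 0 ≤ q := by
  by_contra! hq
  refine absurd h (not_lt.2 ?_)
  rw [← gaussianQ_zero]
  exact measureReal_mono (Set.Ioi_subset_Ioi hq.le)

lemma rescale_mono {L U : ℝ} (h : L ≤ U) : Monotone (rescale L U) := fun _ _ hr =>
  Set.monotone_projIcc _ (div_le_div_of_nonneg_right (sub_le_sub_right hr L) (sub_nonneg.2 h))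

/-- Both laws are translates of the same centred Gaussian, which couples the rewards in order;
clipping preserves the order, though not the means. -/
lemma integral_rescale_gaussianReal_mono {L U : ℝ} (h : L ≤ U) (v : ℝ≥0) {m m' : ℝ}
    (hm : m ≤ m') :
    ∫ r, (rescale L U r : ℝ) ∂gaussianReal m v ≤ ∫ r, (rescale L U r : ℝ) ∂gaussianReal m' v := by
  have hmeas : Measurable fun r => (rescale L U r : ℝ) :=
    measurable_subtype_coe.comp (measurable_rescale L U)
  have shift (a : ℝ) : ∫ r, (rescale L U r : ℝ) ∂gaussianReal a v =
      ∫ r, (rescale L U (r + a) : ℝ) ∂gaussianReal 0 v := by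
    have e := gaussianReal_map_add_const (μ := 0) (v := v) a
    rw [zero_add] at e
    rw [← e, integral_map (measurable_add_const a).aemeasurable hmeas.aestronglyMeasurable]
  have hint (a : ℝ) : Integrable (fun r => (rescale L U (r + a) : ℝ)) (gaussianReal 0 v) :=
    (integrable_rescale L U _).comp_measurable (measurable_add_const a)
  rw [shift, shift]
  exact integral_mono (hint m) (hint m') fun r => rescale_mono h (by linarith)

/-- The arm with the larger mean reward has the larger success probability. -/
lemma successProb_le_of_mean_le {ν : Fin 2 → Measure ℝ} {L U : ℝ} (hν : Rewards ν L U)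
    {i j : Fin 2} (h : mean ν i ≤ mean ν j) : successProb ν L U i ≤ successProb ν L U j := by
  cases hν with
  | gaussian μ σ hσ μmin μmax hμ ε q hε hε' hq =>
    have hq0 : 0 ≤ (σ : ℝ) * q :=
      mul_nonneg σ.2 (nonneg_of_gaussianQ_lt_half (hq.trans_lt hε'))
    have hLU : μmin - σ * q ≤ σ * q + μmax := by linarith [(hμ 0).1.trans (hμ 0).2]
    simp only [mean, integral_id_gaussianReal] at h
    exact integral_rescale_gaussianReal_mono hLU _ h
  | bounded ν hb =>
    have e (i : Fin 2) : successProb ν 0 1 i = mean ν i := by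
      refine integral_congr_ae ?_
      filter_upwards [hb i] with r hr
      simp only [rescale, sub_zero, div_one]
      rw [Set.projIcc_of_mem _ hr]
    rwa [e, e]

/-- With `x = 80 / Δ ^ 2` the logarithmic term is `2 * (x * log x) ≥ 2 * (x - 1) > -2`. It may be
negative, but the constant `2 * 18` absorbs it. -/
lemma two_mul_le_playBound {Δ : ℝ} (hΔ : 0 < Δ) (N : ℕ) : 2 * (N : ℝ) ≤ playBound Δ N := by
  have hx : 0 < 80 / Δ ^ 2 := by positivity
  have hlog := Real.one_sub_inv_le_log_of_pos hx
  have h : 80 / Δ ^ 2 - 1 ≤ 80 / Δ ^ 2 * Real.log (80 / Δ ^ 2) := by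
    refine le_trans (le_of_eq ?_) (mul_le_mul_of_nonneg_left hlog hx.le)
    rw [mul_sub, mul_inv_cancel₀ hx.ne', mul_one]
  have h4 : 0 < 48 / Δ ^ 4 := by positivity
  rw [playBound, show 160 / Δ ^ 2 = 2 * (80 / Δ ^ 2) by ring]
  linarith

/-- Chebyshev's inequality for the lower tail, for a lower bound `a` of the mean. -/
lemma one_sub_variance_div_sq_le {Ω : Type*} [MeasurableSpace Ω] {P : Measure Ω}
    [IsProbabilityMeasure P] {X : Ω → ℝ} (hX : MemLp X 2 P) (hXm : Measurable X) {a s : ℝ}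
    (ha : a ≤ ∫ ω, X ω ∂P) (hs : 0 < s) :
    1 - variance X P / s ^ 2 ≤ P.real {ω | a - s < X ω} := by
  have hcheb := ENNReal.toReal_mono ENNReal.ofReal_ne_top (meas_ge_le_variance_div_sq hX hs)
  rw [ENNReal.toReal_ofReal (div_nonneg (variance_nonneg X P) (sq_nonneg s))] at hcheb
  -- Since `a` is at most the mean, `X ≤ a - s` forces a deviation of at least `s` from the mean.
  have hsub : {ω | a - s < X ω}ᶜ ⊆ {ω | s ≤ |X ω - ∫ ω, X ω ∂P|} := by
    intro ω hω
    simp only [Set.mem_compl_iff, Set.mem_ofPred_eq, not_lt] at hω ⊢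
    rw [abs_sub_comm]
    exact le_trans (by linarith) (le_abs_self _)
  have hc := probReal_compl_eq_one_sub (μ := P) (measurableSet_lt measurable_const hXm :
    MeasurableSet {ω | a - s < X ω})
  have hmono : P.real {ω | a - s < X ω}ᶜ ≤ variance X P / s ^ 2 :=
    (measureReal_mono hsub).trans hcheb
  linarith

end TwoArmedTS

end

theorem lemma2 (ν : Fin 2 → MeasureTheory.Measure ℝ)
    [∀ i, MeasureTheory.IsProbabilityMeasure (ν i)]
    (L U : ℝ) (hν : TwoArmedTS.Rewards ν L U)
    (Δ : ℝ) (hΔ : 0 < Δ)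
    (hgap : ∀ i j, i ≠ j → Δ ≤ |TwoArmedTS.mean ν i - TwoArmedTS.mean ν j|)
    (k : Fin 2) (hk : ∀ i, TwoArmedTS.mean ν i ≤ TwoArmedTS.mean ν k)
    (N T : ℕ) (hT : TwoArmedTS.playBound Δ N ≤ (T : ℝ)) :
    (N : ℝ) ≤ ∫ ω, (TwoArmedTS.plays k T ω : ℝ) ∂(TwoArmedTS.law ν L U) ∧
    ∀ s : ℝ, 0 < s →
      1 - ProbabilityTheory.variance (fun ω => (TwoArmedTS.plays k T ω : ℝ))
            (TwoArmedTS.law ν L U) / s ^ 2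
        ≤ (TwoArmedTS.law ν L U).real {ω | (N : ℝ) - s < (TwoArmedTS.plays k T ω : ℝ)} := by
  have hmean : (N : ℝ) ≤ ∫ ω, (TwoArmedTS.plays k T ω : ℝ) ∂(TwoArmedTS.law ν L U) := by
    refine le_trans ?_ (TwoArmedTS.half_le_integral_plays ν L U k
      (fun i => TwoArmedTS.successProb_le_of_mean_le hν (hk i)) T)
    linarith [TwoArmedTS.two_mul_le_playBound hΔ N]
  exact ⟨hmean, fun s hs => TwoArmedTS.one_sub_variance_div_sq_le
    (TwoArmedTS.memLp_plays ν L U k T 2) (TwoArmedTS.measurable_plays_cast k T) hmean hs⟩
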